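/- \textbf{Setting.} Let $f:(0,\infty)\to\mathbb R$ be twice continuously differentiable with $f''>0$ and $f(1)=0$, and let $\tilde f(r)=r f(1/r)$. For probability densities $p,q$ on $\mathbb R^d$ that are positive on the same set $\mathcal X$ and vanish outside it, let $$D_f(p,q)=\mathbb E_{x\sim q}\!\left[f\!\left(\frac{p(x)}{q(x)}\right)\right].$$ Let $\Theta\subseteq\mathbb R^l$ and $\mathcal X\subseteq\mathbb R^d$ be open, and let $z\sim p_z$ and $\epsilon\sim p_\epsilon$ be independent random elements of measurable spaces $\mathcal Z$ and $\mathcal E$. For $\theta\in\Theta$ let $G_\theta:\mathcal Z\times\mathcal E\to\mathcal X$ be measurable, with $\theta\mapsto G_\theta(z,\epsilon)$ continuously differentiable on $\Theta$ for all $(z,\epsilon)$, and write $\nabla_\theta G_\theta$ for its Jacobian. Let $p_r$ be a probability density that is positive and $C^1$ on $\mathcal X$ and zero outside $\mathcal X$. Suppose that for each $\theta\in\Theta$ the random vector $G_\theta(z,\epsilon)$ has a Lebesgue density $p_\theta$ that is positive and differentiable on $\mathcal X$ and zero outside $\mathcal X$, and that $(\theta,x)\mapsto p_\theta(x)$ and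 $(\theta,x)\mapsto\nabla_x p_\theta(x)$ are continuous on $\Theta\times\mathcal X$. Put $$r_\theta=\frac{p_r}{p_\theta},\qquad \mathcal D_\theta=\log\frac{p_r}{p_\theta},\qquad s_\theta(x)=\frac{\tilde f''(1/r_\theta(x))}{r_\theta(x)}\quad(x\in\mathcal X),$$ and suppose that $L_{\rm uni}(\theta)=D_f(p_r,p_\theta)$ is finite, that is, $f(r_\theta)\,p_\theta$ is Lebesgue integrable, for every $\theta\in\Theta$. \textbf{Theorem.} Let $\theta_0\in\Theta$, and suppose that there are a neighbourhood $U$ of $\theta_0$ in $\Theta$ and a function $M$ on $\mathcal Z\times\mathcal E$ with $\mathbb E_{z,\epsilon}[M(z,\epsilon)]<\infty$ such that, for almost every $(z,\epsilon)$, $$\left\| s_{\theta}(G_{\theta'}(z,\epsilon))\,\nabla_x\mathcal D_{\theta}(G_{\theta'}(z,\epsilon))^\top\nabla_{\theta'}G_{\theta'}(z,\epsilon)\right\|\le M(z,\epsilon)\qquad\text{for all }\theta,\theta'\in U .$$ Then $s_{\theta_0}(G_{\theta_0}(z,\epsilon))\,\nabla_x\mathcal D_{\theta_0}(G_{\theta_0}(z,\epsilon))^\top\nabla_\theta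 G_{\theta_0}(z,\epsilon)$ is integrable, $L_{\rm uni}$ is differentiable at $\theta_0$, and $$\nabla_\theta L_{\rm uni}(\theta_0)=-\,\mathbb E_{z\sim p_z,\ \epsilon\sim p_\epsilon}\!\left[s_{\theta_0}(G_{\theta_0}(z,\epsilon))\,\nabla_x\mathcal D_{\theta_0}(G_{\theta_0}(z,\epsilon))^\top\,\nabla_\theta G_{\theta_0}(z,\epsilon)\right].$$ -/

import Mathlib

open MeasureTheory Set Filter Topology
open scoped Gradient

noncomputable section

namespace UniGen

/-- The class of functions `f` generating the divergences: `f` is twice continuously differentiable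
on `(0, ∞)` with `f'' > 0` there, and `f 1 = 0`. -/
def IsDivergenceFunction (f : ℝ → ℝ) : Prop :=
  ContDiffOn ℝ 2 f (Ioi 0) ∧ (∀ r : ℝ, 0 < r → 0 < deriv (deriv f) r) ∧ f 1 = 0

/-- The conjugate function `r ↦ r f(1/r)`. -/
def fTilde (f : ℝ → ℝ) (r : ℝ) : ℝ := r * f (1 / r)

/-- `p` is a probability density (for Lebesgue measure) that is positive on `S` and vanishes
outside `S`. -/
def IsPositiveDensityOn {d : ℕ} (S : Set (EuclideanSpace ℝ (Fin d)))
    (p : EuclideanSpace ℝ (Fin d) → ℝ) : Prop :=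
  Measurable p ∧ (∀ x ∈ S, 0 < p x) ∧ (∀ x ∉ S, p x = 0) ∧ ∫⁻ x, ENNReal.ofReal (p x) = 1

/-- The density ratio `r = p / q`. -/
def ratio {d : ℕ} (p q : EuclideanSpace ℝ (Fin d) → ℝ) (x : EuclideanSpace ℝ (Fin d)) : ℝ :=
  p x / q x

/-- The log density ratio `log (p / q)`. -/
def logRatio {d : ℕ} (p q : EuclideanSpace ℝ (Fin d) → ℝ) (x : EuclideanSpace ℝ (Fin d)) : ℝ :=
  Real.log (p x / q x)

/-- The scaling factor `s = f̃''(1/r) / r` with `r = p / q`. -/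
def scaling {d : ℕ} (f : ℝ → ℝ) (p q : EuclideanSpace ℝ (Fin d) → ℝ)
    (x : EuclideanSpace ℝ (Fin d)) : ℝ :=
  deriv (deriv (fTilde f)) (1 / ratio p q x) / ratio p q x

/-- The integrand `f(p / q) q` of the `f`-divergence. -/
def divIntegrand {d : ℕ} (f : ℝ → ℝ) (p q : EuclideanSpace ℝ (Fin d) → ℝ)
    (x : EuclideanSpace ℝ (Fin d)) : ℝ :=
  f (ratio p q x) * q x

/-- The `f`-divergence `D_f(p, q) = 𝔼_q[f(p / q)]`. -/
def fDivergence {d : ℕ} (f : ℝ → ℝ) (p q : EuclideanSpace ℝ (Fin d) → ℝ) : ℝ :=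
  ∫ x, divIntegrand f p q x

/-- The vector `s(G_θ(z,ε)) ∇ₓ𝒟(G_θ(z,ε))ᵀ ∇_θ G_θ(z,ε)` of parameter space, where `s` and `𝒟` are
the scaling factor and the log ratio of the densities `p` and `q`. A row vector times the Jacobian
is the adjoint of the derivative applied to the vector. -/
def gradTerm {l d : ℕ} {Z N : Type*} (f : ℝ → ℝ) (p q : EuclideanSpace ℝ (Fin d) → ℝ)
    (G : EuclideanSpace ℝ (Fin l) → Z → N → EuclideanSpace ℝ (Fin d))
    (θ : EuclideanSpace ℝ (Fin l)) (z : Z) (e : N) : EuclideanSpace ℝ (Fin l) :=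
  scaling f p q (G θ z e) •
    (ContinuousLinearMap.adjoint (fderiv ℝ (fun t => G t z e) θ)) (∇ (logRatio p q) (G θ z e))

end UniGen

end

noncomputable section

namespace UniGen

theorem IsDivergenceFunction.contDiffAt {f : ℝ → ℝ} (hf : IsDivergenceFunction f) {r : ℝ}
    (hr : 0 < r) : ContDiffAt ℝ 2 f r :=
  hf.1.contDiffAt (Ioi_mem_nhds hr)

theorem IsDivergenceFunction.hasDerivAt {f : ℝ → ℝ} (hf : IsDivergenceFunction f) {r : ℝ}
    (hr : 0 < r) : HasDerivAt f (deriv f r) r :=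
  ((hf.contDiffAt hr).differentiableAt (by norm_num)).hasDerivAt

theorem IsDivergenceFunction.convexOn {f : ℝ → ℝ} (hf : IsDivergenceFunction f) :
    ConvexOn ℝ (Ioi 0) f := by
  have hd : ContDiffOn ℝ 1 (deriv f) (Ioi 0) :=
    ((contDiffOn_succ_iff_deriv_of_isOpen (n := 1) isOpen_Ioi).1 hf.1).2.2
  refine convexOn_of_deriv2_nonneg' (convex_Ioi 0) (hf.1.differentiableOn (by norm_num))
    (hd.differentiableOn (by norm_num)) fun x hx => ?_
  simpa using (hf.2.1 x hx).le

theorem IsDivergenceFunction.tangent_le {f : ℝ → ℝ} (hf : IsDivergenceFunction f) {a b : ℝ}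
    (ha : 0 < a) (hb : 0 < b) : f a + deriv f a * (b - a) ≤ f b := by
  rcases lt_trichotomy a b with h | rfl | h
  · have := hf.convexOn.le_slope_of_hasDerivAt ha hb h (hf.hasDerivAt ha)
    rw [slope_def_field, le_div_iff₀ (sub_pos.2 h)] at this
    linarith
  · simp
  · have := hf.convexOn.slope_le_of_hasDerivAt hb ha h (hf.hasDerivAt ha)
    rw [slope_def_field, div_le_iff₀ (sub_pos.2 h)] at this
    linarith

theorem IsDivergenceFunction.contDiffOn_fTilde {f : ℝ → ℝ} (hf : IsDivergenceFunction f) :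
    ContDiffOn ℝ 2 (fTilde f) (Ioi 0) := by
  have hinv : ContDiffOn ℝ 2 (fun r : ℝ => 1 / r) (Ioi 0) :=
    contDiffOn_const.div contDiffOn_id fun x hx => (ne_of_gt hx)
  exact contDiffOn_id.mul (hf.1.comp hinv fun x hx => mem_Ioi.2 (one_div_pos.2 hx))

theorem IsDivergenceFunction.contDiffOn_deriv_fTilde {f : ℝ → ℝ} (hf : IsDivergenceFunction f) :
    ContDiffOn ℝ 1 (deriv (fTilde f)) (Ioi 0) :=
  ((contDiffOn_succ_iff_deriv_of_isOpen (n := 1) isOpen_Ioi).1 hf.contDiffOn_fTilde).2.2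

theorem IsDivergenceFunction.continuousOn_deriv_deriv_fTilde {f : ℝ → ℝ}
    (hf : IsDivergenceFunction f) : ContinuousOn (deriv (deriv (fTilde f))) (Ioi 0) :=
  hf.contDiffOn_deriv_fTilde.continuousOn_deriv_of_isOpen isOpen_Ioi le_rfl

theorem IsDivergenceFunction.deriv_fTilde {f : ℝ → ℝ} (hf : IsDivergenceFunction f) {u : ℝ}
    (hu : 0 < u) : deriv (fTilde f) u = f (1 / u) - deriv f (1 / u) / u := by
  have h1 : HasDerivAt (fun r : ℝ => 1 / r) (-(u ^ 2)⁻¹) u := by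
    simpa using hasDerivAt_inv hu.ne'
  have h2 := (hasDerivAt_id u).mul ((hf.hasDerivAt (one_div_pos.2 hu)).comp u h1)
  refine (show HasDerivAt (fTilde f) _ u from h2).deriv.trans ?_
  simp only [id, Function.comp]
  field_simp
  ring

theorem IsDivergenceFunction.fTilde_tangent_le {f : ℝ → ℝ} (hf : IsDivergenceFunction f) {a b : ℝ}
    (ha : 0 < a) (hb : 0 < b) :
    deriv (fTilde f) a * (b - a) ≤ fTilde f b - fTilde f a := by
  have h := mul_le_mul_of_nonneg_left
    (hf.tangent_le (one_div_pos.2 ha) (one_div_pos.2 hb)) hb.le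
  rw [hf.deriv_fTilde ha]
  have e : b * (f (1 / a) + deriv f (1 / a) * (1 / b - 1 / a)) =
      (f (1 / a) - deriv f (1 / a) / a) * (b - a) + a * f (1 / a) := by
    field_simp
    ring
  simp only [fTilde]
  linarith

/-- The derivative `f̃'(q / p)` of the `f`-divergence `D_f(p, q)` with respect to `q`. -/
def dualScore {d : ℕ} (f : ℝ → ℝ) (p q : EuclideanSpace ℝ (Fin d) → ℝ)
    (x : EuclideanSpace ℝ (Fin d)) : ℝ :=
  deriv (fTilde f) (q x / p x)

theorem dualScore_mul_sub_le {d : ℕ} {f : ℝ → ℝ} (hf : IsDivergenceFunction f)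
    {p q q' : EuclideanSpace ℝ (Fin d) → ℝ} {x : EuclideanSpace ℝ (Fin d)}
    (hp : 0 < p x) (hq : 0 < q x) (hq' : 0 < q' x) :
    dualScore f p q x * (q' x - q x) ≤ divIntegrand f p q' x - divIntegrand f p q x := by
  have key : ∀ a : ℝ, 0 < a → f (p x / a) * a = p x * fTilde f (a / p x) := fun a ha => by
    simp only [fTilde, one_div_div]
    field_simp
  have h := mul_le_mul_of_nonneg_left
    (hf.fTilde_tangent_le (div_pos hq hp) (div_pos hq' hp)) hp.le
  simp only [divIntegrand, ratio, dualScore, key _ hq, key _ hq']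
  have e : p x * (deriv (fTilde f) (q x / p x) * (q' x / p x - q x / p x)) =
      deriv (fTilde f) (q x / p x) * (q' x - q x) := by
    field_simp
  linarith

theorem measurable_dualScore {d : ℕ} (f : ℝ → ℝ) {p q : EuclideanSpace ℝ (Fin d) → ℝ}
    (hp : Measurable p) (hq : Measurable q) : Measurable (dualScore f p q) :=
  (measurable_deriv (fTilde f)).comp (hq.div hp)

/-- The truncation of a real number to `[-k, k]`. -/
def clamp (k h : ℝ) : ℝ := max (-k) (min k h)

theorem abs_clamp_le {k : ℝ} (hk : 0 ≤ k) (h : ℝ) : |clamp k h| ≤ k :=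
  abs_le.2 ⟨le_max_left _ _, max_le (by linarith) (min_le_left _ _)⟩

theorem abs_clamp_sub_clamp_le (k a b : ℝ) : |clamp k a - clamp k b| ≤ |a - b| := by
  refine (abs_max_sub_max_le_max _ _ _ _).trans ?_
  simp only [sub_self, abs_zero]
  refine max_le (abs_nonneg _) ((abs_min_sub_min_le_max _ _ _ _).trans ?_)
  simp

theorem clamp_eq_self {k h : ℝ} (hk : |h| ≤ k) : clamp k h = h := by
  rw [clamp, min_eq_right (abs_le.1 hk).2, max_eq_right (abs_le.1 hk).1]

theorem tendsto_clamp (h : ℝ) : Tendsto (fun k : ℕ => clamp k h) atTop (𝓝 h) := by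
  refine tendsto_const_nhds.congr' ?_
  filter_upwards [(tendsto_natCast_atTop_atTop (R := ℝ)).eventually_ge_atTop |h|] with k hk
  exact (clamp_eq_self hk).symm

theorem measurable_clamp (k : ℝ) : Measurable (clamp k) :=
  measurable_const.max (measurable_const.min measurable_id)

/-- The factor by which truncation to `[-k, k]` shrinks a real number. -/
def clampFactor (k h : ℝ) : ℝ := k / max k |h|

theorem clampFactor_mul {k : ℝ} (hk : 0 < k) (h : ℝ) : clampFactor k h * h = clamp k h := by
  unfold clampFactor clamp
  rcases le_total |h| k with hh | hh
  · have := abs_le.1 hh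
    rw [max_eq_left hh, min_eq_right this.2, max_eq_right this.1, div_self hk.ne', one_mul]
  · rw [max_eq_right hh]
    rcases le_total 0 h with h0 | h0
    · rw [abs_of_nonneg h0] at hh ⊢
      rw [min_eq_left hh, max_eq_right (by linarith), div_mul_cancel₀ _ (by linarith)]
    · rw [abs_of_nonpos h0] at hh ⊢
      have : h ≠ 0 := by intro e; subst e; linarith
      rw [min_eq_right (by linarith), max_eq_left (by linarith)]
      field_simp

theorem clampFactor_nonneg {k : ℝ} (hk : 0 ≤ k) (h : ℝ) : 0 ≤ clampFactor k h :=
  div_nonneg hk (hk.trans (le_max_left _ _))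

theorem clampFactor_le_one {k : ℝ} (hk : 0 ≤ k) (h : ℝ) : clampFactor k h ≤ 1 :=
  div_le_one_of_le₀ (le_max_left _ _) (hk.trans (le_max_left _ _))

theorem measurable_clampFactor (k : ℝ) : Measurable (clampFactor k) :=
  measurable_const.div (measurable_const.max measurable_norm)

theorem tendsto_clampFactor (h : ℝ) :
    Tendsto (fun k : ℕ => clampFactor k h) atTop (𝓝 1) := by
  refine tendsto_const_nhds.congr' ?_
  filter_upwards [(tendsto_natCast_atTop_atTop (R := ℝ)).eventually_ge_atTop |h|,
    eventually_gt_atTop 0] with k hk hk0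
  rw [clampFactor, max_eq_left hk, div_self (by exact_mod_cast hk0.ne')]

theorem integral_comp_eq_integral_mul_density {Ω X : Type*} [MeasurableSpace Ω]
    [MeasurableSpace X] {P : Measure Ω} {μ : Measure X} {Y : Ω → X} (hY : Measurable Y)
    {q : X → ℝ} (hq : Measurable q) (hq0 : ∀ x, 0 ≤ q x)
    (hlaw : P.map Y = μ.withDensity fun x => ENNReal.ofReal (q x))
    {H : X → ℝ} (hH : Measurable H) :
    ∫ w, H (Y w) ∂P = ∫ x, H x * q x ∂μ := by
  rw [← integral_map hY.aemeasurable hH.aestronglyMeasurable, hlaw,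
    integral_withDensity_eq_integral_toReal_smul hq.ennreal_ofReal (by simp)]
  refine integral_congr_ae (Eventually.of_forall fun x => ?_)
  simp [ENNReal.toReal_ofReal (hq0 x), mul_comm]

/-- If `Y` and `Y₀` have densities `q` and `q₀` and `h (q - q₀)` lies below an integrable function
`D`, then `𝔼[h(Y) - h(Y₀)] ≤ ∫ D`. Neither `h(Y)` nor `h(Y₀)` is assumed to be integrable. -/
theorem integral_comp_sub_comp_le {Ω X : Type*} [MeasurableSpace Ω]
    [MeasurableSpace X] {P : Measure Ω} [IsFiniteMeasure P] {μ : Measure X} {Y Y₀ : Ω → X}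
    (hY : Measurable Y) (hY₀ : Measurable Y₀) {q q₀ : X → ℝ} (hq : Integrable q μ)
    (hqm : Measurable q) (hq0 : ∀ x, 0 ≤ q x) (hq₀ : Integrable q₀ μ) (hq₀m : Measurable q₀)
    (hq₀0 : ∀ x, 0 ≤ q₀ x)
    (hlaw : P.map Y = μ.withDensity fun x => ENNReal.ofReal (q x))
    (hlaw₀ : P.map Y₀ = μ.withDensity fun x => ENNReal.ofReal (q₀ x))
    {h D : X → ℝ} (hh : Measurable h) (hD : Integrable D μ)
    (hle : ∀ x, h x * (q x - q₀ x) ≤ D x)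
    (hint : Integrable (fun w => h (Y w) - h (Y₀ w)) P) :
    ∫ w, (h (Y w) - h (Y₀ w)) ∂P ≤ ∫ x, D x ∂μ := by
  have hcm : ∀ k : ℕ, Measurable fun x => clamp k (h x) := fun k => (measurable_clamp k).comp hh
  have hcb : ∀ (k : ℕ) a, |clamp k a| ≤ k := fun k a => abs_clamp_le (Nat.cast_nonneg k) a
  have hL : Tendsto (fun k : ℕ => ∫ w, (clamp k (h (Y w)) - clamp k (h (Y₀ w))) ∂P) atTop
      (𝓝 (∫ w, (h (Y w) - h (Y₀ w)) ∂P)) := by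
    refine tendsto_integral_of_dominated_convergence (fun w => |h (Y w) - h (Y₀ w)|) (fun k => ?_)
      hint.abs (fun k => Eventually.of_forall fun w => abs_clamp_sub_clamp_le _ _ _)
      (Eventually.of_forall fun w => (tendsto_clamp _).sub (tendsto_clamp _))
    exact (((hcm k).comp hY).sub ((hcm k).comp hY₀)).aestronglyMeasurable
  have hR : Tendsto (fun k : ℕ => ∫ x, clampFactor k (h x) * D x ∂μ) atTop
      (𝓝 (∫ x, D x ∂μ)) := by
    refine tendsto_integral_of_dominated_convergence (fun x => |D x|) (fun k => ?_)
      hD.abs (fun k => Eventually.of_forall fun x => ?_)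
      (Eventually.of_forall fun x => by
        simpa using (tendsto_clampFactor (h x)).mul_const (D x))
    · exact ((measurable_clampFactor k).comp hh).aestronglyMeasurable.mul hD.1
    · rw [Real.norm_eq_abs, abs_mul, abs_of_nonneg (clampFactor_nonneg (Nat.cast_nonneg k) _)]
      exact mul_le_of_le_one_left (abs_nonneg _) (clampFactor_le_one (Nat.cast_nonneg k) _)
  refine le_of_tendsto_of_tendsto hL hR ?_
  filter_upwards [eventually_gt_atTop 0] with k hk
  have hk' : (0 : ℝ) < k := by exact_mod_cast hk
  have hi : ∀ {V : Ω → X}, Measurable V → Integrable (fun w => clamp k (h (V w))) P := fun hV =>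
    Integrable.of_bound ((hcm k).comp hV).aestronglyMeasurable k
      (Eventually.of_forall fun w => hcb k _)
  have hi' : ∀ {g : X → ℝ}, Integrable g μ → Integrable (fun x => clamp k (h x) * g x) μ :=
    fun hg => hg.bdd_mul (hcm k).aestronglyMeasurable (Eventually.of_forall fun x => hcb k _)
  rw [integral_sub (hi hY) (hi hY₀), integral_comp_eq_integral_mul_density hY hqm hq0 hlaw (hcm k),
    integral_comp_eq_integral_mul_density hY₀ hq₀m hq₀0 hlaw₀ (hcm k),
    ← integral_sub (hi' hq) (hi' hq₀)]
  refine integral_mono ((hi' hq).sub (hi' hq₀)) (hD.bdd_mul (c := 1)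
    ((measurable_clampFactor k).comp hh).aestronglyMeasurable (Eventually.of_forall fun x => ?_))
    fun x => ?_
  · rw [Real.norm_eq_abs, abs_of_nonneg (clampFactor_nonneg hk'.le _)]
    exact clampFactor_le_one hk'.le _
  · have := mul_le_mul_of_nonneg_left (hle x) (clampFactor_nonneg hk'.le (h x))
    simp only [← clampFactor_mul hk']
    linarith

section Gradients

variable {d : ℕ} {f : ℝ → ℝ} {p q : EuclideanSpace ℝ (Fin d) → ℝ} {x : EuclideanSpace ℝ (Fin d)}

theorem hasGradientAt_logRatio (hp : DifferentiableAt ℝ p x) (hq : DifferentiableAt ℝ q x)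
    (hp0 : 0 < p x) (hq0 : 0 < q x) :
    HasGradientAt (logRatio p q) ((p x)⁻¹ • ∇ p x - (q x)⁻¹ • ∇ q x) x := by
  have h1 := (hp.hasFDerivAt.log hp0.ne').sub (hq.hasFDerivAt.log hq0.ne')
  rw [hasGradientAt_iff_hasFDerivAt]
  simp only [map_sub, map_smul, toDual_gradient]
  refine HasFDerivAt.congr_of_eventuallyEq (f := fun y => Real.log (p y) - Real.log (q y)) h1 ?_
  filter_upwards [hp.continuousAt.eventually_ne hp0.ne',
    hq.continuousAt.eventually_ne hq0.ne'] with y h2 h3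
  exact Real.log_div h2 h3

theorem hasGradientAt_dualScore (hf : IsDivergenceFunction f) (hp : DifferentiableAt ℝ p x)
    (hq : DifferentiableAt ℝ q x) (hp0 : 0 < p x) (hq0 : 0 < q x) :
    HasGradientAt (dualScore f p q) (-(scaling f p q x • ∇ (logRatio p q) x)) x := by
  have hu : 0 < q x / p x := div_pos hq0 hp0
  have h2 : HasDerivAt (deriv (fTilde f)) (deriv (deriv (fTilde f)) (q x / p x)) (q x / p x) :=
    ((hf.contDiffOn_deriv_fTilde.contDiffAt (Ioi_mem_nhds hu)).differentiableAt
      (by norm_num)).hasDerivAt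
  have h1 := h2.comp_hasFDerivAt x
    (hq.hasFDerivAt.mul ((hasDerivAt_inv hp0.ne').comp_hasFDerivAt x hp.hasFDerivAt))
  rw [(hasGradientAt_logRatio hp hq hp0 hq0).gradient, hasGradientAt_iff_hasFDerivAt]
  refine (show HasFDerivAt (dualScore f p q) _ x from h1).congr_fderiv ?_
  simp only [map_sub, map_neg, map_smul, toDual_gradient]
  ext v
  simp only [scaling, ratio, one_div_div, smul_apply, sub_apply, neg_apply, add_apply,
    smul_eq_mul, Function.comp]
  field_simp
  ring

end Gradients

section Parameters

variable {l d : ℕ} {Z N : Type*} {f : ℝ → ℝ} {Θ : Set (EuclideanSpace ℝ (Fin l))}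
  {S : Set (EuclideanSpace ℝ (Fin d))}
  {G : EuclideanSpace ℝ (Fin l) → Z → N → EuclideanSpace ℝ (Fin d)}
  {pr : EuclideanSpace ℝ (Fin d) → ℝ}
  {p : EuclideanSpace ℝ (Fin l) → EuclideanSpace ℝ (Fin d) → ℝ}

theorem continuousOn_scaling (hf : IsDivergenceFunction f)
    (hpr : ∀ x ∈ S, 0 < pr x) (hprc : ContinuousOn pr S) (hp : ∀ θ ∈ Θ, ∀ x ∈ S, 0 < p θ x)
    (hpcont : ContinuousOn (fun y : EuclideanSpace ℝ (Fin l) × EuclideanSpace ℝ (Fin d) =>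
      p y.1 y.2) (Θ ×ˢ S)) :
    ContinuousOn (fun y : EuclideanSpace ℝ (Fin l) × EuclideanSpace ℝ (Fin d) =>
      scaling f pr (p y.1) y.2) (Θ ×ˢ S) := by
  have hpr' : ContinuousOn (fun y : EuclideanSpace ℝ (Fin l) × EuclideanSpace ℝ (Fin d) =>
      pr y.2) (Θ ×ˢ S) := hprc.comp continuousOn_snd fun y hy => hy.2
  have hr := hpr'.div hpcont fun y hy => (hp _ hy.1 _ hy.2).ne'
  have hr' := hpcont.div hpr' fun y hy => (hpr _ hy.2).ne'
  simp only [scaling, ratio, one_div_div]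
  exact (hf.continuousOn_deriv_deriv_fTilde.comp hr' fun y hy =>
    mem_Ioi.2 (div_pos (hp _ hy.1 _ hy.2) (hpr _ hy.2))).div hr fun y hy =>
    (div_pos (hpr _ hy.2) (hp _ hy.1 _ hy.2)).ne'

theorem continuousOn_gradient_logRatio (hS : IsOpen S)
    (hpr : ∀ x ∈ S, 0 < pr x) (hprdiff : ContDiffOn ℝ 1 pr S)
    (hp : ∀ θ ∈ Θ, ∀ x ∈ S, 0 < p θ x) (hpdiff : ∀ θ ∈ Θ, DifferentiableOn ℝ (p θ) S)
    (hpcont : ContinuousOn (fun y : EuclideanSpace ℝ (Fin l) × EuclideanSpace ℝ (Fin d) =>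
      p y.1 y.2) (Θ ×ˢ S))
    (hpgrad : ContinuousOn (fun y : EuclideanSpace ℝ (Fin l) × EuclideanSpace ℝ (Fin d) =>
      ∇ (p y.1) y.2) (Θ ×ˢ S)) :
    ContinuousOn (fun y : EuclideanSpace ℝ (Fin l) × EuclideanSpace ℝ (Fin d) =>
      ∇ (logRatio pr (p y.1)) y.2) (Θ ×ˢ S) := by
  have hpr' : ContinuousOn (fun y : EuclideanSpace ℝ (Fin l) × EuclideanSpace ℝ (Fin d) =>
      pr y.2) (Θ ×ˢ S) := hprdiff.continuousOn.comp continuousOn_snd fun y hy => hy.2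
  have hg : ContinuousOn (∇ pr) S :=
    (InnerProductSpace.toDual ℝ _).symm.continuous.comp_continuousOn
      (hprdiff.continuousOn_fderiv_of_isOpen hS le_rfl)
  have hg' : ContinuousOn (fun y : EuclideanSpace ℝ (Fin l) × EuclideanSpace ℝ (Fin d) =>
      ∇ pr y.2) (Θ ×ˢ S) := hg.comp continuousOn_snd fun y hy => hy.2
  refine (((hpr'.inv₀ fun y hy => (hpr _ hy.2).ne').smul hg').sub
    ((hpcont.inv₀ fun y hy => (hp _ hy.1 _ hy.2).ne').smul hpgrad)).congr fun y hy => ?_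
  have hn := hS.mem_nhds hy.2
  exact (hasGradientAt_logRatio ((hprdiff.differentiableOn one_ne_zero).differentiableAt hn)
    ((hpdiff _ hy.1).differentiableAt hn) (hpr _ hy.2) (hp _ hy.1 _ hy.2)).gradient

theorem continuousOn_gradTerm (hf : IsDivergenceFunction f) (hΘ : IsOpen Θ) (hS : IsOpen S)
    (hGS : ∀ θ ∈ Θ, ∀ z e, G θ z e ∈ S)
    (hGdiff : ∀ z e, ContDiffOn ℝ 1 (fun θ => G θ z e) Θ)
    (hpr : ∀ x ∈ S, 0 < pr x) (hprdiff : ContDiffOn ℝ 1 pr S)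
    (hp : ∀ θ ∈ Θ, ∀ x ∈ S, 0 < p θ x) (hpdiff : ∀ θ ∈ Θ, DifferentiableOn ℝ (p θ) S)
    (hpcont : ContinuousOn (fun y : EuclideanSpace ℝ (Fin l) × EuclideanSpace ℝ (Fin d) =>
      p y.1 y.2) (Θ ×ˢ S))
    (hpgrad : ContinuousOn (fun y : EuclideanSpace ℝ (Fin l) × EuclideanSpace ℝ (Fin d) =>
      ∇ (p y.1) y.2) (Θ ×ˢ S)) (z : Z) (e : N) :
    ContinuousOn (fun y : EuclideanSpace ℝ (Fin l) × EuclideanSpace ℝ (Fin l) =>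
      gradTerm f pr (p y.1) G y.2 z e) (Θ ×ˢ Θ) := by
  have hm : ContinuousOn (fun y : EuclideanSpace ℝ (Fin l) × EuclideanSpace ℝ (Fin l) =>
      (y.1, G y.2 z e)) (Θ ×ˢ Θ) :=
    continuousOn_fst.prodMk ((hGdiff z e).continuousOn.comp continuousOn_snd fun y hy => hy.2)
  have hmaps : MapsTo (fun y : EuclideanSpace ℝ (Fin l) × EuclideanSpace ℝ (Fin l) =>
      (y.1, G y.2 z e)) (Θ ×ˢ Θ) (Θ ×ˢ S) := fun y hy => ⟨hy.1, hGS _ hy.2 z e⟩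
  have h1 := (continuousOn_scaling hf hpr hprdiff.continuousOn hp hpcont).comp hm hmaps
  have h2 := (continuousOn_gradient_logRatio hS hpr hprdiff hp hpdiff hpcont hpgrad).comp hm hmaps
  have h3 : ContinuousOn (fun y : EuclideanSpace ℝ (Fin l) × EuclideanSpace ℝ (Fin l) =>
      ContinuousLinearMap.adjoint (fderiv ℝ (fun t => G t z e) y.2)) (Θ ×ˢ Θ) :=
    ContinuousLinearMap.adjoint.continuous.comp_continuousOn
      (((hGdiff z e).continuousOn_fderiv_of_isOpen hΘ le_rfl).comp continuousOn_snd
        fun y hy => hy.2)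
  exact h1.smul (h3.clm_apply h2)

theorem hasGradientAt_dualScore_comp (hf : IsDivergenceFunction f) (hΘ : IsOpen Θ)
    (hS : IsOpen S) (hGS : ∀ θ ∈ Θ, ∀ z e, G θ z e ∈ S)
    (hGdiff : ∀ z e, ContDiffOn ℝ 1 (fun θ => G θ z e) Θ)
    (hpr : ∀ x ∈ S, 0 < pr x) (hprdiff : ContDiffOn ℝ 1 pr S)
    {q : EuclideanSpace ℝ (Fin d) → ℝ}
    (hq : ∀ x ∈ S, 0 < q x) (hqdiff : DifferentiableOn ℝ q S)
    (z : Z) (e : N) {θ : EuclideanSpace ℝ (Fin l)} (hθ : θ ∈ Θ) :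
    HasGradientAt (fun t => dualScore f pr q (G t z e)) (-gradTerm f pr q G θ z e) θ := by
  have hx := hGS θ hθ z e
  have hn := hS.mem_nhds hx
  have h1 := hasGradientAt_dualScore hf
    ((hprdiff.differentiableOn one_ne_zero).differentiableAt hn)
    (hqdiff.differentiableAt hn) (hpr _ hx) (hq _ hx)
  have h2 : HasFDerivAt (fun t => G t z e) (fderiv ℝ (fun t => G t z e) θ) θ :=
    (((hGdiff z e).differentiableOn one_ne_zero).differentiableAt
      (hΘ.mem_nhds hθ)).hasFDerivAt
  rw [hasGradientAt_iff_hasFDerivAt] at h1 ⊢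
  refine (h1.comp θ h2).congr_fderiv ?_
  ext v
  simp [gradTerm, ContinuousLinearMap.adjoint_inner_left]

end Parameters

section Domination

variable {E Ω : Type*} [NormedAddCommGroup E] [InnerProductSpace ℝ E] [CompleteSpace E]

/-- The mean value theorem on a ball. -/
theorem exists_inner_eq_sub_of_hasGradientAt {H : E → ℝ} {g : E → E} {x₀ x : E} {r : ℝ}
    (hH : ∀ y ∈ Metric.ball x₀ r, HasGradientAt H (g y) y) (hx : x ∈ Metric.ball x₀ r) :
    ∃ y ∈ Metric.ball x₀ r, dist y x₀ ≤ dist x x₀ ∧ H x - H x₀ = inner ℝ (g y) (x - x₀) := by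
  have hline : ∀ t ∈ Icc (0 : ℝ) 1, dist (x₀ + t • (x - x₀)) x₀ ≤ dist x x₀ := fun t ht => by
    rw [dist_eq_norm, add_sub_cancel_left, norm_smul, Real.norm_of_nonneg ht.1, dist_eq_norm]
    exact mul_le_of_le_one_left (norm_nonneg _) ht.2
  have hmem : ∀ t ∈ Icc (0 : ℝ) 1, x₀ + t • (x - x₀) ∈ Metric.ball x₀ r := fun t ht =>
    (hline t ht).trans_lt hx
  have hd : ∀ t ∈ Icc (0 : ℝ) 1, HasDerivAt (fun s : ℝ => H (x₀ + s • (x - x₀)))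
      (inner ℝ (g (x₀ + t • (x - x₀))) (x - x₀)) t := fun t ht => by
    have h1 : HasDerivAt (fun s : ℝ => x₀ + s • (x - x₀)) (x - x₀) t := by
      simpa using ((hasDerivAt_id t).smul_const (x - x₀)).const_add x₀
    exact (hasGradientAt_iff_hasFDerivAt.1 (hH _ (hmem t ht))).comp_hasDerivAt t h1
  obtain ⟨c, hc, h⟩ := exists_hasDerivAt_eq_slope (fun s : ℝ => H (x₀ + s • (x - x₀)))
    (fun t => inner ℝ (g (x₀ + t • (x - x₀))) (x - x₀)) zero_lt_one
    (fun t ht => (hd t ht).continuousAt.continuousWithinAt) fun t ht => hd t (Ioo_subset_Icc_self ht)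
  refine ⟨_, hmem c (Ioo_subset_Icc_self hc), hline c (Ioo_subset_Icc_self hc), ?_⟩
  simpa using h.symm

/-- The moving-base form of differentiation under the integral sign: `τ` selects, for each `x`, the
function of the family `H` whose increment from `x₀` to `x` is integrated. -/
theorem isLittleO_integral_sub_sub_inner [MeasurableSpace Ω] {P : Measure Ω} {H : E → E → Ω → ℝ}
    {g : E → E → Ω → E} {x₀ : E} {U : Set E} (hU : U ∈ 𝓝 x₀)
    (hH : ∀ x ∈ U, ∀ y ∈ U, ∀ w, HasGradientAt (fun t => H x t w) (g x y w) y)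
    (hmeas : ∀ x ∈ U, ∀ y ∈ U, AEStronglyMeasurable (H x y) P)
    (hcont : ∀ w, ContinuousAt (fun y : E × E => g y.1 y.2 w) (x₀, x₀))
    (hg : Integrable (g x₀ x₀) P) {M : Ω → ℝ} (hM : Integrable M P)
    (hle : ∀ᵐ w ∂P, ∀ x ∈ U, ∀ y ∈ U, ‖g x y w‖ ≤ M w)
    {τ : E → E} (hτ : Tendsto τ (𝓝 x₀) (𝓝 x₀)) :
    (∀ᶠ x in 𝓝 x₀, Integrable (fun w => H (τ x) x w - H (τ x) x₀ w) P) ∧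
    (fun x => ∫ w, (H (τ x) x w - H (τ x) x₀ w) ∂P - inner ℝ (∫ w, g x₀ x₀ w ∂P) (x - x₀))
      =o[𝓝 x₀] fun x => x - x₀ := by
  obtain ⟨r, hr, hrU⟩ := Metric.mem_nhds_iff.1 hU
  have hx₀ : x₀ ∈ U := mem_of_mem_nhds hU
  have hmv : ∀ w, ∀ t ∈ U, ∀ x ∈ Metric.ball x₀ r, ∃ y ∈ U, dist y x₀ ≤ dist x x₀ ∧
      H t x w - H t x₀ w = inner ℝ (g t y w) (x - x₀) := fun w t ht x hx => by
    obtain ⟨y, hy, h1, h2⟩ := exists_inner_eq_sub_of_hasGradientAt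
      (fun y hy => hH t ht y (hrU hy) w) hx
    exact ⟨y, hrU hy, h1, h2⟩
  have hev : ∀ᶠ x in 𝓝 x₀, τ x ∈ U ∧ x ∈ Metric.ball x₀ r :=
    (hτ.eventually_mem hU).and (Metric.ball_mem_nhds x₀ hr)
  have hmeas' : ∀ x, τ x ∈ U ∧ x ∈ Metric.ball x₀ r →
      AEStronglyMeasurable (fun w => H (τ x) x w - H (τ x) x₀ w) P := fun x hx =>
    (hmeas _ hx.1 _ (hrU hx.2)).sub (hmeas _ hx.1 _ hx₀)
  have hint : ∀ x, τ x ∈ U ∧ x ∈ Metric.ball x₀ r →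
      Integrable (fun w => H (τ x) x w - H (τ x) x₀ w) P := fun x hx => by
    refine (hM.mul_const ‖x - x₀‖).mono' (hmeas' x hx) ?_
    filter_upwards [hle] with w hw
    obtain ⟨y, hy, -, h⟩ := hmv w _ hx.1 x hx.2
    rw [h]
    exact (norm_inner_le_norm _ _).trans
      (mul_le_mul_of_nonneg_right (hw _ hx.1 _ hy) (norm_nonneg _))
  refine ⟨hev.mono hint, ?_⟩
  have hlim : Tendsto (fun x => ∫ w, ‖x - x₀‖⁻¹ *
      (H (τ x) x w - H (τ x) x₀ w - inner ℝ (g x₀ x₀ w) (x - x₀)) ∂P) (𝓝 x₀)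
      (𝓝 (∫ _, (0 : ℝ) ∂P)) := by
    refine tendsto_integral_filter_of_dominated_convergence (fun w => 2 * M w) ?_ ?_
      (hM.const_mul 2) (Eventually.of_forall fun w => ?_)
    · filter_upwards [hev] with x hx
      exact ((hmeas' x hx).sub (hg.1.inner aestronglyMeasurable_const)).const_mul _
    · filter_upwards [hev] with x hx
      filter_upwards [hle] with w hw
      obtain ⟨y, hy, -, h⟩ := hmv w _ hx.1 x hx.2
      rw [h, ← inner_sub_left, norm_mul, norm_inv, norm_norm]
      calc ‖x - x₀‖⁻¹ * ‖inner ℝ (g (τ x) y w - g x₀ x₀ w) (x - x₀)‖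
          ≤ ‖x - x₀‖⁻¹ * (‖g (τ x) y w - g x₀ x₀ w‖ * ‖x - x₀‖) :=
            mul_le_mul_of_nonneg_left (norm_inner_le_norm _ _) (by positivity)
        _ = ‖g (τ x) y w - g x₀ x₀ w‖ * (‖x - x₀‖⁻¹ * ‖x - x₀‖) := by ring
        _ ≤ ‖g (τ x) y w - g x₀ x₀ w‖ * 1 :=
            mul_le_mul_of_nonneg_left inv_mul_le_one (norm_nonneg _)
        _ ≤ 2 * M w := by
            linarith [norm_sub_le (g (τ x) y w) (g x₀ x₀ w), hw _ hx.1 _ hy, hw _ hx₀ _ hx₀]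
    · rw [Metric.tendsto_nhds]
      intro ε hε
      obtain ⟨δ, hδ, hc⟩ := Metric.continuousAt_iff.1 (hcont w) ε hε
      filter_upwards [hev, hτ.eventually (Metric.ball_mem_nhds x₀ hδ),
        Metric.ball_mem_nhds x₀ hδ] with x hx h1 h2
      obtain ⟨y, hy, hyx, h⟩ := hmv w _ hx.1 x hx.2
      have h3 : ‖g (τ x) y w - g x₀ x₀ w‖ < ε := by
        rw [← dist_eq_norm]
        exact hc (x := (τ x, y)) (max_lt h1 (hyx.trans_lt h2))
      rw [dist_zero_right, h, ← inner_sub_left, norm_mul, norm_inv, norm_norm]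
      refine lt_of_le_of_lt ?_ h3
      calc ‖x - x₀‖⁻¹ * ‖inner ℝ (g (τ x) y w - g x₀ x₀ w) (x - x₀)‖
          ≤ ‖x - x₀‖⁻¹ * (‖g (τ x) y w - g x₀ x₀ w‖ * ‖x - x₀‖) :=
            mul_le_mul_of_nonneg_left (norm_inner_le_norm _ _) (by positivity)
        _ = ‖g (τ x) y w - g x₀ x₀ w‖ * (‖x - x₀‖⁻¹ * ‖x - x₀‖) := by ring
        _ ≤ ‖g (τ x) y w - g x₀ x₀ w‖ := mul_le_of_le_one_right (norm_nonneg _) inv_mul_le_one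
  rw [integral_zero] at hlim
  rw [← Asymptotics.isLittleO_norm_right, Asymptotics.isLittleO_iff_tendsto']
  · refine hlim.congr' ?_
    filter_upwards [hev] with x hx
    rw [integral_const_mul, integral_sub (hint x hx) (hg.inner_const _), div_eq_inv_mul]
    congr 2
    simp_rw [real_inner_comm (x - x₀)]
    rw [integral_inner hg]
  · refine Eventually.of_forall fun x hx => ?_
    rw [norm_eq_zero, sub_eq_zero] at hx
    simp [hx]

/-- The gradient of a measurable family of functions is measurable. -/
theorem measurable_of_hasGradientAt {l : ℕ} [MeasurableSpace Ω]
    {H : EuclideanSpace ℝ (Fin l) → Ω → ℝ} {g : Ω → EuclideanSpace ℝ (Fin l)}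
    {x₀ : EuclideanSpace ℝ (Fin l)} {U : Set (EuclideanSpace ℝ (Fin l))} (hU : U ∈ 𝓝 x₀)
    (hmeas : ∀ x ∈ U, Measurable (H x)) (hH : ∀ w, HasGradientAt (fun t => H t w) (g w) x₀) :
    Measurable g := by
  have key : ∀ v : EuclideanSpace ℝ (Fin l), Measurable fun w => inner ℝ (g w) v := fun v => by
    have hline : Tendsto (fun n : ℕ => x₀ + (1 / ((n : ℝ) + 1)) • v) atTop (𝓝 x₀) := by
      simpa using ((tendsto_one_div_add_atTop_nhds_zero_nat (𝕜 := ℝ)).smul_const v).const_add x₀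
    obtain ⟨n₀, hn₀⟩ := eventually_atTop.1 (hline.eventually_mem hU)
    have hle := fun n : ℕ => hn₀ (n + n₀) (Nat.le_add_left _ _)
    refine measurable_of_tendsto_metrizable (f := fun (n : ℕ) w => (((n + n₀ : ℕ) : ℝ) + 1) *
      (H (x₀ + (1 / (((n + n₀ : ℕ) : ℝ) + 1)) • v) w - H x₀ w)) (fun n => ?_) ?_
    · exact ((hmeas _ (hle n)).sub (hmeas _ (mem_of_mem_nhds hU))).const_mul _
    · refine tendsto_pi_nhds.2 fun w => ?_
      have h := hasGradientAt_iff_hasFDerivAt.1 (hH w)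
      have h2 : Tendsto (fun n : ℕ => ((n : ℝ) + 1) • (H (x₀ + (1 / ((n : ℝ) + 1)) • v) w
          - H x₀ w)) atTop (𝓝 (inner ℝ (g w) v)) := by
        have := h.lim_real v
        have h3 := this.comp (tendsto_atTop_add_const_right atTop (1 : ℝ)
          tendsto_natCast_atTop_atTop)
        simpa [Function.comp_def] using h3
      simpa [Function.comp_def] using h2.comp (tendsto_add_atTop_nat n₀)
  have e : g = fun w => ∑ i, inner ℝ (g w) (EuclideanSpace.basisFun (Fin l) ℝ i) •
      EuclideanSpace.basisFun (Fin l) ℝ i := by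
    funext w
    conv_lhs => rw [← (EuclideanSpace.basisFun (Fin l) ℝ).sum_repr' (g w)]
    simp_rw [real_inner_comm]
  rw [e]
  exact Finset.measurable_sum _ fun i _ => (key _).smul_const _

end Domination

theorem IsPositiveDensityOn.nonneg {d : ℕ} {S : Set (EuclideanSpace ℝ (Fin d))}
    {p : EuclideanSpace ℝ (Fin d) → ℝ} (hp : IsPositiveDensityOn S p)
    (x : EuclideanSpace ℝ (Fin d)) : 0 ≤ p x := by
  by_cases hx : x ∈ S
  · exact (hp.2.1 x hx).le
  · exact (hp.2.2.1 x hx).ge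

theorem IsPositiveDensityOn.integrable {d : ℕ} {S : Set (EuclideanSpace ℝ (Fin d))}
    {p : EuclideanSpace ℝ (Fin d) → ℝ} (hp : IsPositiveDensityOn S p) : Integrable p := by
  refine ⟨hp.1.aestronglyMeasurable, ?_⟩
  rw [hasFiniteIntegral_iff_ofReal (Eventually.of_forall hp.nonneg), hp.2.2.2]
  exact ENNReal.one_lt_top

/-- The tangent inequality for the `f`-divergence in its second argument, in terms of random
vectors with densities `q` and `q'`. -/
theorem integral_dualScore_sub_le {Ω : Type*} [MeasurableSpace Ω] {P : Measure Ω}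
    [IsFiniteMeasure P] {d : ℕ} {f : ℝ → ℝ} (hf : IsDivergenceFunction f)
    {S : Set (EuclideanSpace ℝ (Fin d))} {pr q q' : EuclideanSpace ℝ (Fin d) → ℝ}
    (hpr : IsPositiveDensityOn S pr) (hq : IsPositiveDensityOn S q)
    (hq' : IsPositiveDensityOn S q') {Y Y' : Ω → EuclideanSpace ℝ (Fin d)}
    (hY : Measurable Y) (hY' : Measurable Y')
    (hlaw : P.map Y = volume.withDensity fun x => ENNReal.ofReal (q x))
    (hlaw' : P.map Y' = volume.withDensity fun x => ENNReal.ofReal (q' x))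
    (hfin : Integrable (divIntegrand f pr q)) (hfin' : Integrable (divIntegrand f pr q'))
    (hint : Integrable (fun w => dualScore f pr q (Y' w) - dualScore f pr q (Y w)) P) :
    ∫ w, (dualScore f pr q (Y' w) - dualScore f pr q (Y w)) ∂P ≤
      fDivergence f pr q' - fDivergence f pr q := by
  rw [fDivergence, fDivergence, ← integral_sub hfin' hfin]
  refine integral_comp_sub_comp_le hY' hY hq'.integrable hq'.1 hq'.nonneg hq.integrable hq.1
    hq.nonneg hlaw' hlaw (measurable_dualScore f hpr.1 hq.1) (hfin'.sub hfin) (fun x => ?_) hint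
  by_cases hx : x ∈ S
  · exact dualScore_mul_sub_le hf (hpr.2.1 x hx) (hq.2.1 x hx) (hq'.2.1 x hx)
  · simp [divIntegrand, hq.2.2.1 x hx, hq'.2.2.1 x hx]

end UniGen

end

theorem mainTheorem2 {l d : ℕ} {Z N : Type*} [MeasurableSpace Z] [MeasurableSpace N]
    -- the laws of the latent variable and of the noise
    (Pz : Measure Z) [IsProbabilityMeasure Pz] (Pe : Measure N) [IsProbabilityMeasure Pe]
    (f : ℝ → ℝ) (hf : UniGen.IsDivergenceFunction f)
    -- the parameter domain and the data space
    (Θ : Set (EuclideanSpace ℝ (Fin l))) (hΘ : IsOpen Θ)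
    (S : Set (EuclideanSpace ℝ (Fin d))) (hS : IsOpen S)
    -- the generator: measurable in `(z, ε)`, continuously differentiable in `θ`
    (G : EuclideanSpace ℝ (Fin l) → Z → N → EuclideanSpace ℝ (Fin d))
    (hGS : ∀ θ ∈ Θ, ∀ z e, G θ z e ∈ S)
    (hGmeas : ∀ θ ∈ Θ, Measurable (fun w : Z × N => G θ w.1 w.2))
    (hGdiff : ∀ z e, ContDiffOn ℝ 1 (fun θ => G θ z e) Θ)
    -- the density of the real data
    (pr : EuclideanSpace ℝ (Fin d) → ℝ) (hpr : UniGen.IsPositiveDensityOn S pr)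
    (hprdiff : ContDiffOn ℝ 1 pr S)
    -- the density of `G_θ(z, ε)`
    (p : EuclideanSpace ℝ (Fin l) → EuclideanSpace ℝ (Fin d) → ℝ)
    (hp : ∀ θ ∈ Θ, UniGen.IsPositiveDensityOn S (p θ))
    (hplaw : ∀ θ ∈ Θ, (Pz.prod Pe).map (fun w : Z × N => G θ w.1 w.2) =
      volume.withDensity (fun x => ENNReal.ofReal (p θ x)))
    (hpdiff : ∀ θ ∈ Θ, DifferentiableOn ℝ (p θ) S)
    (hpcont : ContinuousOn (fun y : EuclideanSpace ℝ (Fin l) × EuclideanSpace ℝ (Fin d) =>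
      p y.1 y.2) (Θ ×ˢ S))
    (hpgrad : ContinuousOn (fun y : EuclideanSpace ℝ (Fin l) × EuclideanSpace ℝ (Fin d) =>
      ∇ (p y.1) y.2) (Θ ×ˢ S))
    -- the objective is finite
    (hfin : ∀ θ ∈ Θ, Integrable (UniGen.divIntegrand f pr (p θ)))
    (θ₀ : EuclideanSpace ℝ (Fin l)) (hθ₀ : θ₀ ∈ Θ)
    -- local domination, for differentiation under the expectation
    (hdom : ∃ U ∈ 𝓝 θ₀, ∃ M : Z × N → ℝ, Integrable M (Pz.prod Pe) ∧
      ∀ᵐ w ∂(Pz.prod Pe), ∀ θ ∈ U, ∀ θ' ∈ U,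
        ‖UniGen.gradTerm f pr (p θ) G θ' w.1 w.2‖ ≤ M w) :
    Integrable (fun w : Z × N => UniGen.gradTerm f pr (p θ₀) G θ₀ w.1 w.2) (Pz.prod Pe) ∧
    HasGradientAt (fun θ => UniGen.fDivergence f pr (p θ))
      (-∫ w, UniGen.gradTerm f pr (p θ₀) G θ₀ w.1 w.2 ∂(Pz.prod Pe)) θ₀ := by
  obtain ⟨U₀, hU₀, M, hM, hle₀⟩ := hdom
  set U := U₀ ∩ Θ with hUdef
  have hU : U ∈ 𝓝 θ₀ := inter_mem hU₀ (hΘ.mem_nhds hθ₀)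
  have hle : ∀ᵐ w ∂(Pz.prod Pe), ∀ θ ∈ U, ∀ θ' ∈ U,
      ‖-UniGen.gradTerm f pr (p θ) G θ' w.1 w.2‖ ≤ M w := by
    filter_upwards [hle₀] with w hw θ hθ θ' hθ'
    rw [norm_neg]
    exact hw θ hθ.1 θ' hθ'.1
  have hH : ∀ θ ∈ U, ∀ θ' ∈ U, ∀ w : Z × N,
      HasGradientAt (fun t => UniGen.dualScore f pr (p θ) (G t w.1 w.2))
        (-UniGen.gradTerm f pr (p θ) G θ' w.1 w.2) θ' := fun θ hθ θ' hθ' w =>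
    UniGen.hasGradientAt_dualScore_comp hf hΘ hS hGS hGdiff hpr.2.1 hprdiff (hp θ hθ.2).2.1
      (hpdiff θ hθ.2) w.1 w.2 hθ'.2
  have hmeas : ∀ θ ∈ U, ∀ θ' ∈ U,
      Measurable fun w : Z × N => UniGen.dualScore f pr (p θ) (G θ' w.1 w.2) :=
    fun θ hθ θ' hθ' => (UniGen.measurable_dualScore f hpr.1 (hp θ hθ.2).1).comp (hGmeas θ' hθ'.2)
  have hθU : θ₀ ∈ U := mem_of_mem_nhds hU
  have hcont : ∀ w : Z × N, ContinuousAt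
      (fun y : EuclideanSpace ℝ (Fin l) × EuclideanSpace ℝ (Fin l) =>
        -UniGen.gradTerm f pr (p y.1) G y.2 w.1 w.2) (θ₀, θ₀) := fun w =>
    ((UniGen.continuousOn_gradTerm hf hΘ hS hGS hGdiff hpr.2.1 hprdiff
      (fun θ hθ => (hp θ hθ).2.1) hpdiff hpcont hpgrad w.1 w.2).continuousAt
      ((hΘ.prod hΘ).mem_nhds ⟨hθ₀, hθ₀⟩)).neg
  have hg : Integrable (fun w : Z × N => -UniGen.gradTerm f pr (p θ₀) G θ₀ w.1 w.2)
      (Pz.prod Pe) := by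
    refine hM.mono' (UniGen.measurable_of_hasGradientAt hU (fun θ hθ => hmeas θ₀ hθU θ hθ)
      (hH θ₀ hθU θ₀ hθU)).aestronglyMeasurable ?_
    filter_upwards [hle] with w hw
    exact hw _ hθU _ hθU
  refine ⟨by simpa using hg.neg, ?_⟩
  have main := fun (τ : EuclideanSpace ℝ (Fin l) → EuclideanSpace ℝ (Fin l))
      (hτ : Tendsto τ (𝓝 θ₀) (𝓝 θ₀)) =>
    UniGen.isLittleO_integral_sub_sub_inner (P := Pz.prod Pe)
      (H := fun θ θ' w => UniGen.dualScore f pr (p θ) (G θ' w.1 w.2))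
      (g := fun θ θ' w => -UniGen.gradTerm f pr (p θ) G θ' w.1 w.2) hU hH
      (fun θ hθ θ' hθ' => (hmeas θ hθ θ' hθ').aestronglyMeasurable) hcont hg hM hle hτ
  obtain ⟨hi₁, ho₁⟩ := main (fun _ => θ₀) tendsto_const_nhds
  obtain ⟨hi₂, ho₂⟩ := main (fun θ => θ) tendsto_id
  rw [← integral_neg, hasGradientAt_iff_isLittleO]
  refine Asymptotics.IsBigO.trans_isLittleO (g := fun θ =>
    |_| + |_|) (Asymptotics.IsBigO.of_bound 1 ?_) (ho₁.abs_left.add ho₂.abs_left)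
  filter_upwards [hi₁, hi₂, hU] with θ h₁ h₂ hθ
  have hlow := UniGen.integral_dualScore_sub_le hf hpr (hp θ₀ hθ₀) (hp θ hθ.2) (hGmeas θ₀ hθ₀)
    (hGmeas θ hθ.2) (hplaw θ₀ hθ₀) (hplaw θ hθ.2) (hfin θ₀ hθ₀) (hfin θ hθ.2) h₁
  have hup := UniGen.integral_dualScore_sub_le hf hpr (hp θ hθ.2) (hp θ₀ hθ₀) (hGmeas θ hθ.2)
    (hGmeas θ₀ hθ₀) (hplaw θ hθ.2) (hplaw θ₀ hθ₀) (hfin θ hθ.2) (hfin θ₀ hθ₀)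
    (by simpa only [Pi.neg_def, neg_sub] using h₂.neg)
  have hswap : ∫ w : Z × N, (UniGen.dualScore f pr (p θ) (G θ₀ w.1 w.2) -
      UniGen.dualScore f pr (p θ) (G θ w.1 w.2)) ∂(Pz.prod Pe) =
      -∫ w : Z × N, (UniGen.dualScore f pr (p θ) (G θ w.1 w.2) -
      UniGen.dualScore f pr (p θ) (G θ₀ w.1 w.2)) ∂(Pz.prod Pe) := by
    rw [← integral_neg]
    simp
  rw [hswap] at hup
  rw [one_mul, Real.norm_eq_abs, Real.norm_eq_abs, abs_of_nonneg (a := |_| + |_|) (by positivity)]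
  refine abs_le.2 ⟨?_, ?_⟩
  · refine le_trans (neg_le_neg (le_add_of_nonneg_right (abs_nonneg _))) ?_
    refine (neg_abs_le _).trans ?_
    linarith
  · refine le_trans ?_ (le_add_of_nonneg_left (abs_nonneg _))
    refine le_trans ?_ (le_abs_self _)
    linarith
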